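/- Let $p$ be a prime with $p \equiv 1$ or $3 \pmod 8$, let $\left(\frac{\cdot}{p}\right)$ denote the Legendre symbol modulo $p$ (with value $0$ at multiples of $p$), and set $$A=\frac12\sum_{x=0}^{p-1}\left(\frac{x^3+4x^2+2x}{p}\right).$$ If $p\equiv 1 \pmod 8$, let $n$ be any integer that is a quadratic nonresidue modulo $p$ and set $$B=\frac14\sum_{x=0}^{p-1}\left(\frac{x^5+nx}{p}\right).$$ If $p\equiv 3 \pmod 8$, set $$B=\frac14\left(1+\sum_{x=0}^{p-1}\left(\frac{x^6+4x^5+10x^4-20x^2-16x-8}{p}\right)\right).$$ Then, in both cases, $A$ and $B$ are integers and satisfy $A^2+2B^2=p$. -/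

import Mathlib

open Polynomial

/-- The Jacobsthal sum `∑_{x=0}^{p-1} (f(x) / p)` of a polynomial `f ∈ ℤ[x]`, where `(· / p)` is the
Legendre symbol modulo the prime `p`. -/
noncomputable def jacobsthalSum (p : ℕ) [Fact p.Prime] (f : ℤ[X]) : ℤ :=
  ∑ x ∈ Finset.range p, legendreSym p (f.eval (x : ℤ))

/-- `A = (1/2) ∑_{x=0}^{p-1} ((x³ + 4x² + 2x) / p)`, as a rational number. -/
noncomputable def sumA (p : ℕ) [Fact p.Prime] : ℚ :=
  (1 / 2 : ℚ) * (jacobsthalSum p (X ^ 3 + 4 * X ^ 2 + 2 * X) : ℚ)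

/-- `B = (1/4) ∑_{x=0}^{p-1} ((x⁵ + n x) / p)`, as a rational number. -/
noncomputable def sumB₁ (p : ℕ) [Fact p.Prime] (n : ℤ) : ℚ :=
  (1 / 4 : ℚ) * (jacobsthalSum p (X ^ 5 + C n * X) : ℚ)

/-- `B = (1/4) (1 + ∑_{x=0}^{p-1} ((x⁶ + 4x⁵ + 10x⁴ - 20x² - 16x - 8) / p))`,
as a rational number. -/
noncomputable def sumB₃ (p : ℕ) [Fact p.Prime] : ℚ :=
  (1 / 4 : ℚ) * (1 + (jacobsthalSum p
    (X ^ 6 + 4 * X ^ 5 + 10 * X ^ 4 - 20 * X ^ 2 - 16 * X - 8) : ℚ))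

/-! Write J for the cubic sum and S for the sum in B, including its `1 +` when p ≡ 3 (mod 8). Both
cases come down to 2J² + S² = 8p; parity then gives J = 2A, S = 4B with A, B integers.

The identity is a second-moment computation. Let f be an integer function on a finite field with q
elements such that f(m⁴n) = χ(m) f(n), together with a symmetry n ↦ n^(2j+1), j odd. Then f² is
constant on fourth powers, vanishes on the other nonzero squares, and is constant on nonsquares, so
4 ∑ f² = (q - 1)(f(1)² + 2 f(n)²) for any nonsquare n (`four_mul_sum_sq`). It remains to compute ∑
f² by orthogonality and to recognise f(1) as a multiple of 2J.

For p ≡ 1 (mod 8), f(n) = ∑ χ(x⁵ + nx) over 𝔽_p, and the symmetry is n ↦ n⁻¹. For p ≡ 3 (mod 8), -1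
is a nonsquare in 𝔽_p, so the argument moves to 𝔽_p(√2): f is `quarticSum` and the symmetry is
Frobenius, i.e. conjugation. -/

/-! ### Quadratic character sums and the second-moment principle -/

section QuadraticCharacterSums

variable {F : Type*} [Field F] [Fintype F]

theorem sum_comp_affine (f : F → ℤ) {a : F} (ha : a ≠ 0) (b : F) :
    ∑ x, f (a * x + b) = ∑ x, f x :=
  Equiv.sum_comp ((Equiv.mulLeft₀ a ha).trans (Equiv.addRight b)) f

variable [DecidableEq F]

theorem sum_comp_sq (hF : ringChar F ≠ 2) (f : F → ℤ) :
    ∑ x, f (x ^ 2) = ∑ s, (1 + quadraticChar F s) * f s := by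
  rw [← Finset.sum_fiberwise Finset.univ (fun x : F => x ^ 2)]
  refine Finset.sum_congr rfl fun s _ => ?_
  rw [Finset.sum_congr rfl (g := fun _ => f s)
    (fun x hx => by rw [(Finset.mem_filter.mp hx).2]), Finset.sum_const, nsmul_eq_mul,
    add_comm, ← quadraticChar_card_sqrts hF s]
  congr 2
  simp

theorem sum_quadraticChar_affine (hF : ringChar F ≠ 2) {a : F} (ha : a ≠ 0) (b : F) :
    ∑ x, quadraticChar F (a * x + b) = 0 := by
  rw [sum_comp_affine _ ha, quadraticChar_sum_zero hF]

theorem sum_quadraticChar_sq : ∑ x, quadraticChar F x ^ 2 = (Fintype.card F : ℤ) - 1 := by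
  have h : ∀ x : F, quadraticChar F x ^ 2 = 1 - if x = 0 then 1 else 0 := by
    intro x
    split_ifs with hx
    · simp [hx]
    · rw [quadraticChar_sq_one hx, sub_zero]
  simp only [h, Finset.sum_sub_distrib]
  simp

theorem quadraticChar_sq_mul (x : F) {y : F} (hy : y ≠ 0) :
    quadraticChar F (y ^ 2 * x) = quadraticChar F x := by
  rw [map_mul, quadraticChar_sq_one' hy, one_mul]

theorem exists_sq_of_quadraticChar_eq_one {x : F} (h : quadraticChar F x = 1) :
    ∃ y, y ≠ 0 ∧ x = y ^ 2 := by
  have hx : x ≠ 0 := by rintro rfl; simp at h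
  obtain ⟨y, rfl⟩ := (quadraticChar_one_iff_isSquare hx).mp h
  exact ⟨y, left_ne_zero_of_mul hx, (sq y).symm⟩

/-- Since j is odd, n ↦ n^(2j+1) fixes each square class modulo fourth powers but swaps the two
nonsquare classes. On squares of nonsquares it forces f = -f; on nonsquares it identifies the two
values of f². -/
theorem four_mul_sum_sq (hF : ringChar F ≠ 2) (f : F → ℤ) (f0 : f 0 = 0) {j : ℕ} (hj : Odd j)
    (h1 : ∀ m n, m ≠ 0 → f (m ^ 4 * n) = quadraticChar F m * f n)
    (h2 : ∀ n, n ≠ 0 → f (n ^ (2 * j + 1)) ^ 2 = f n ^ 2)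
    (h3 : ∀ m, m ≠ 0 → f ((m ^ 2) ^ (2 * j + 1)) = f (m ^ 2))
    {n : F} (hn : quadraticChar F n = -1) :
    4 * ∑ x, f x ^ 2 = ((Fintype.card F : ℤ) - 1) * (f 1 ^ 2 + 2 * f n ^ 2) := by
  have h1sq : ∀ m n, m ≠ 0 → f (m ^ 4 * n) ^ 2 = f n ^ 2 := fun m n hm => by
    rw [h1 m n hm, mul_pow, quadraticChar_sq_one hm, one_mul]
  have n0 : n ≠ 0 := by rintro rfl; simp at hn
  have hsq : ∀ m : F, 2 * f (m ^ 2) ^ 2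
      = (quadraticChar F m ^ 2 + quadraticChar F m) * f 1 ^ 2 := by
    intro m
    rcases eq_or_ne m 0 with rfl | hm
    · simp [f0]
    rcases quadraticChar_dichotomy hm with h | h
    · obtain ⟨k, hk, rfl⟩ := exists_sq_of_quadraticChar_eq_one h
      have := h1sq k 1 hk
      rw [h, ← pow_mul]
      rw [mul_one] at this
      rw [this]
      ring
    · have e : (m ^ 2) ^ (2 * j + 1) = (m ^ j) ^ 4 * m ^ 2 := by ring
      have := h3 m hm
      rw [e, h1 _ _ (pow_ne_zero _ hm), map_pow, h, hj.neg_one_pow] at this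
      have : f (m ^ 2) = 0 := by linarith
      rw [this, h]
      ring
  have hns : ∀ x : F, (1 - quadraticChar F x) * f x ^ 2
      = (quadraticChar F x ^ 2 - quadraticChar F x) * f n ^ 2 := by
    intro x
    rcases eq_or_ne x 0 with rfl | hx
    · simp [f0]
    rcases quadraticChar_dichotomy hx with h | h
    · simp [h]
    suffices f n ^ 2 = f x ^ 2 by rw [h, this]; ring
    have hr : quadraticChar F (n * x) = 1 := by rw [map_mul, hn, h]; rfl
    obtain ⟨m, hm, hmx⟩ := exists_sq_of_quadraticChar_eq_one hr
    have hnm : n = (m / x) ^ 2 * x := by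
      field_simp
      linear_combination hmx
    have hmx0 : m / x ≠ 0 := div_ne_zero hm hx
    rcases quadraticChar_dichotomy hmx0 with h' | h'
    · obtain ⟨k, hk, hk'⟩ := exists_sq_of_quadraticChar_eq_one h'
      rw [hnm, hk', ← pow_mul]
      exact h1sq k x hk
    · have hxj : x ^ j ≠ 0 := pow_ne_zero _ hx
      have h'' : quadraticChar F (m / x * x ^ j) = 1 := by
        rw [map_mul, map_pow, h, h', hj.neg_one_pow]; rfl
      obtain ⟨k, hk, hk'⟩ := exists_sq_of_quadraticChar_eq_one h''
      have e : n = (k / x ^ j) ^ 4 * x ^ (2 * j + 1) := by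
        have : (k / x ^ j) ^ 4 = (k ^ 2) ^ 2 / (x ^ j) ^ 4 := by ring
        rw [this, ← hk', hnm]
        field_simp
        ring
      rw [e, h1sq _ _ (div_ne_zero hk hxj), h2 x hx]
  have e1 := sum_comp_sq hF (fun x => f x ^ 2)
  have e2 : 2 * ∑ m : F, f (m ^ 2) ^ 2 = ((Fintype.card F : ℤ) - 1) * f 1 ^ 2 := by
    rw [Finset.mul_sum, Finset.sum_congr rfl fun m _ => hsq m, ← Finset.sum_mul,
      Finset.sum_add_distrib, sum_quadraticChar_sq, quadraticChar_sum_zero hF, add_zero]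
  have e3 : ∑ x : F, (1 - quadraticChar F x) * f x ^ 2
      = ((Fintype.card F : ℤ) - 1) * f n ^ 2 := by
    rw [Finset.sum_congr rfl fun m _ => hns m, ← Finset.sum_mul,
      Finset.sum_sub_distrib, sum_quadraticChar_sq, quadraticChar_sum_zero hF, sub_zero]
  have e4 : 2 * ∑ x : F, f x ^ 2 = ∑ x : F, (1 + quadraticChar F x) * f x ^ 2
      + ∑ x : F, (1 - quadraticChar F x) * f x ^ 2 := by
    rw [← Finset.sum_add_distrib, Finset.mul_sum]
    exact Finset.sum_congr rfl fun x _ => by ring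
  linear_combination 2 * e4 + 2 * e3 + e2 - 2 * e1

theorem sum_quadraticChar_cubic (hF : ringChar F ≠ 2) :
    ∑ s, quadraticChar F ((1 - s) * (s ^ 2 + 6 * s + 1))
      = quadraticChar F (-2) * ∑ x, quadraticChar F (x ^ 3 + 4 * x ^ 2 + 2 * x) := by
  have two : (2 : F) ≠ 0 := Ring.two_ne_zero hF
  rw [← sum_comp_affine _ two 1, Finset.mul_sum]
  refine Finset.sum_congr rfl fun x _ => ?_
  rw [← map_mul, ← quadraticChar_sq_mul _ two]
  rw [← quadraticChar_sq_mul (-2 * (x ^ 3 + 4 * x ^ 2 + 2 * x)) (mul_ne_zero two two)]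
  congr 1
  ring

/-- Inversion s ↦ s⁻¹ works because s² + 6s + 1 is palindromic; the -1 corrects for s = 0, where
`0⁻¹ = 0`. -/
theorem sum_quadraticChar_quartic :
    ∑ s, quadraticChar F (s * ((1 - s) * (s ^ 2 + 6 * s + 1)))
      = quadraticChar F (-1) *
        (∑ s, quadraticChar F ((1 - s) * (s ^ 2 + 6 * s + 1)) - 1) := by
  rw [← Equiv.sum_comp (Equiv.inv F)]
  have h : ∀ t : F, quadraticChar F (t⁻¹ * ((1 - t⁻¹) * (t⁻¹ ^ 2 + 6 * t⁻¹ + 1)))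
      = quadraticChar F (-1) * quadraticChar F ((1 - t) * (t ^ 2 + 6 * t + 1))
        - if t = 0 then quadraticChar F (-1) else 0 := by
    intro t
    split_ifs with ht
    · simp [ht]
    · rw [sub_zero, ← map_mul, ← quadraticChar_sq_mul _ (pow_ne_zero 2 ht)]
      congr 1
      field_simp
      ring
  simp only [Equiv.inv_apply, h, Finset.sum_sub_distrib, ← Finset.mul_sum]
  simp [mul_sub]

theorem sum_quadraticChar_sextic (hF : ringChar F ≠ 2) (c : F) (hc : c ≠ 0) :
    ∑ x, quadraticChar F ((c - x ^ 2) * (x ^ 4 + 6 * c * x ^ 2 + c ^ 2))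
      = quadraticChar F c * ∑ s, quadraticChar F ((1 - s) * (s ^ 2 + 6 * s + 1))
        + quadraticChar F (-1) *
          (∑ s, quadraticChar F ((1 - s) * (s ^ 2 + 6 * s + 1)) - 1) := by
  have := sum_comp_sq hF fun s : F => quadraticChar F ((c - s) * (s ^ 2 + 6 * c * s + c ^ 2))
  simp only [← pow_mul, Nat.reduceMul] at this
  rw [this, ← sum_comp_affine _ hc 0, ← sum_quadraticChar_quartic, Finset.mul_sum,
    ← Finset.sum_add_distrib]
  refine Finset.sum_congr rfl fun s _ => ?_
  rw [add_mul, one_mul, ← map_mul, ← map_mul,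
    ← quadraticChar_sq_mul (c * ((1 - s) * (s ^ 2 + 6 * s + 1))) hc,
    ← quadraticChar_sq_mul (s * ((1 - s) * (s ^ 2 + 6 * s + 1))) (pow_ne_zero 2 hc)]
  congr 2 <;> ring

end QuadraticCharacterSums

/-! ### The case p ≡ 1 (mod 8): quintic sums -/

section QuinticSums

variable {F : Type*} [Field F] [Fintype F] [DecidableEq F]

theorem sum_quadraticChar_add_mul_add (hF : ringChar F ≠ 2) (a b : F) :
    ∑ n, quadraticChar F (a + n) * quadraticChar F (b + n)
      = (if a = b then (Fintype.card F : ℤ) else 0) - 1 := by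
  split_ifs with hab
  · subst hab
    rw [← sum_quadraticChar_sq (F := F), ← sum_comp_affine (fun x => quadraticChar F x ^ 2)
      one_ne_zero a]
    exact Finset.sum_congr rfl fun n _ => by rw [sq, one_mul, add_comm]
  · have hab' : b - a ≠ 0 := sub_ne_zero.mpr (Ne.symm hab)
    rw [← sum_comp_affine _ one_ne_zero (-a), ← Equiv.sum_comp (Equiv.inv F)]
    have h : ∀ n : F, quadraticChar F (a + (1 * n⁻¹ + -a)) * quadraticChar F (b + (1 * n⁻¹ + -a))
        = quadraticChar F ((b - a) * n + 1) - if n = 0 then 1 else 0 := by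
      intro n
      split_ifs with hn
      · simp [hn]
      · rw [sub_zero, ← map_mul, ← quadraticChar_sq_mul _ hn]
        congr 1
        field_simp
        ring
    simp only [Equiv.inv_apply, h, Finset.sum_sub_distrib]
    rw [sum_quadraticChar_affine hF hab']
    simp

theorem sum_quadraticChar_fourth_roots (hF : ringChar F ≠ 2) (h1 : quadraticChar F (-1) = 1)
    (h2 : quadraticChar F 2 = 1) :
    ∑ u : F, (if u ^ 4 = 1 then quadraticChar F u else 0) = 4 := by
  obtain ⟨i, hi, hi2⟩ := exists_sq_of_quadraticChar_eq_one h1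
  have two : (2 : F) ≠ 0 := Ring.two_ne_zero hF
  have hχi : quadraticChar F i = 1 := by
    have hi1 : 1 + i ≠ 0 := by
      intro h
      apply two
      linear_combination (1 - i) * h - hi2
    -- (1 + i)² = 2i and 2 is a square, so i is a square.
    have h : quadraticChar F ((1 + i) ^ 2) = quadraticChar F (2 * i) := by
      congr 1
      linear_combination -hi2
    rw [quadraticChar_sq_one' hi1, map_mul, h2, one_mul] at h
    exact h.symm
  have hset : (Finset.univ.filter fun u : F => u ^ 4 = 1) = {1, -1, i, -i} := by
    ext u
    simp only [Finset.mem_filter, Finset.mem_univ, true_and, Finset.mem_insert,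
      Finset.mem_singleton]
    constructor
    · intro hu
      have : (u - 1) * ((u + 1) * ((u - i) * (u + i))) = 0 := by
        linear_combination hu + (u ^ 2 - 1) * hi2
      simpa [sub_eq_zero, add_eq_zero_iff_eq_neg] using this
    · rintro (rfl | rfl | rfl | rfl)
      · ring
      · ring
      · linear_combination -(u ^ 2 - 1) * hi2
      · linear_combination -(i ^ 2 - 1) * hi2
  have e1 : (1 : F) ≠ -1 := fun h => two (by linear_combination h)
  have e2 : (1 : F) ≠ i := by rintro rfl; exact two (by linear_combination -hi2)
  have e3 : (1 : F) ≠ -i := fun h => two (by linear_combination -hi2 + (1 - i) * h)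
  have e4 : (-1 : F) ≠ i := by rintro rfl; exact two (by linear_combination -hi2)
  have e5 : (-1 : F) ≠ -i := fun h => e2 (by linear_combination -h)
  have e6 : i ≠ -i := fun h => mul_ne_zero two hi (by linear_combination h)
  rw [← Finset.sum_filter, hset, Finset.sum_insert (by simp [e1, e2, e3]),
    Finset.sum_insert (by simp only [Finset.mem_insert, Finset.mem_singleton]; tauto),
    Finset.sum_pair e6, map_one, h1, hχi, neg_eq_neg_one_mul i, map_mul, h1, hχi]
  rfl

/-- After expanding, the sum over n keeps only pairs with x⁴ = y⁴, up to a constant -1 killed by ∑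
χ(y) = 0. Putting y = xu leaves the four fourth roots of unity, all squares. -/
theorem sum_sq_quintic (hF : ringChar F ≠ 2) (h1 : quadraticChar F (-1) = 1)
    (h2 : quadraticChar F 2 = 1) :
    ∑ n : F, (∑ x, quadraticChar F (x ^ 5 + n * x)) ^ 2
      = 4 * (Fintype.card F : ℤ) * ((Fintype.card F : ℤ) - 1) := by
  have expand : ∀ n : F, (∑ x, quadraticChar F (x ^ 5 + n * x)) ^ 2
      = ∑ x, ∑ y, quadraticChar F x * quadraticChar F y *
        (quadraticChar F (x ^ 4 + n) * quadraticChar F (y ^ 4 + n)) := by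
    intro n
    rw [sq, Finset.sum_mul_sum]
    refine Finset.sum_congr rfl fun x _ => Finset.sum_congr rfl fun y _ => ?_
    simp only [← map_mul]
    congr 1
    ring
  have inner : ∀ x : F, ∑ y, quadraticChar F x * quadraticChar F y *
      ((if x ^ 4 = y ^ 4 then (Fintype.card F : ℤ) else 0) - 1)
      = 4 * (Fintype.card F : ℤ) * quadraticChar F x ^ 2 := by
    intro x
    rcases eq_or_ne x 0 with rfl | hx
    · simp [quadraticChar_zero, -quadraticChar_apply]
    have : ∀ y : F, quadraticChar F x * quadraticChar F (x * y + 0) *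
        ((if x ^ 4 = (x * y + 0) ^ 4 then (Fintype.card F : ℤ) else 0) - 1)
        = (Fintype.card F : ℤ) * quadraticChar F x ^ 2 *
            (if y ^ 4 = 1 then quadraticChar F y else 0)
          - quadraticChar F x ^ 2 * quadraticChar F y := by
      intro y
      have h : x ^ 4 = (x * y) ^ 4 ↔ y ^ 4 = 1 := by
        rw [mul_pow, eq_comm, mul_eq_left₀ (pow_ne_zero 4 hx)]
      simp only [add_zero, map_mul, if_congr h rfl rfl]
      split_ifs <;> ring
    rw [← sum_comp_affine _ hx 0, Finset.sum_congr rfl fun y _ => this y,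
      Finset.sum_sub_distrib, ← Finset.mul_sum, ← Finset.mul_sum,
      sum_quadraticChar_fourth_roots hF h1 h2, quadraticChar_sum_zero hF]
    ring
  rw [Finset.sum_congr rfl fun n _ => expand n, Finset.sum_comm]
  simp_rw [fun x : F => Finset.sum_comm (s := (Finset.univ : Finset F)) (t := Finset.univ)
    (f := fun n y => quadraticChar F x * quadraticChar F y *
        (quadraticChar F (x ^ 4 + n) * quadraticChar F (y ^ 4 + n))), ← Finset.mul_sum,
    sum_quadraticChar_add_mul_add hF, inner]
  rw [← Finset.mul_sum, sum_quadraticChar_sq]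

theorem sum_quintic_one (hF : ringChar F ≠ 2) (h1 : quadraticChar F (-1) = 1)
    (h2 : quadraticChar F 2 = 1) :
    ∑ x, quadraticChar F (x ^ 5 + 1 * x)
      = 2 * ∑ x, quadraticChar F (x ^ 3 + 4 * x ^ 2 + 2 * x) := by
  have two : (2 : F) ≠ 0 := Ring.two_ne_zero hF
  have h12 : quadraticChar F (-2) = 1 := by
    rw [neg_eq_neg_one_mul, map_mul, h1, h2]; rfl
  have hs := sum_quadraticChar_sextic hF (1 : F) one_ne_zero
  rw [sum_quadraticChar_cubic hF, h12, h1, map_one] at hs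
  -- the substitution `x = 2 / (1 - y) - 1`
  rw [← sum_comp_affine _ two (-1), ← Equiv.sum_comp (Equiv.inv F),
    ← sum_comp_affine _ (neg_ne_zero.mpr one_ne_zero) 1]
  have h : ∀ y : F, quadraticChar F ((2 * (-1 * y + 1)⁻¹ + -1) ^ 5
      + 1 * (2 * (-1 * y + 1)⁻¹ + -1))
      = quadraticChar F ((1 - y ^ 2) * (y ^ 4 + 6 * 1 * y ^ 2 + 1 ^ 2))
        + if y = 1 then 1 else 0 := by
    intro y
    -- At y = 1 the convention `0⁻¹ = 0` gives x = -1, with χ(-2) = 1, while the sextic vanishes.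
    -- This 1 cancels the -1 in `hs`.
    split_ifs with hy
    · subst hy
      norm_num [quadraticChar_zero, -quadraticChar_apply, h12]
    · have hy' : -1 * y + 1 ≠ 0 := fun h => hy (by linear_combination -h)
      rw [add_zero, ← quadraticChar_sq_mul _ (pow_ne_zero 3 hy')]
      have : ((-1 * y + 1) ^ 3) ^ 2 * ((2 * (-1 * y + 1)⁻¹ + -1) ^ 5
          + 1 * (2 * (-1 * y + 1)⁻¹ + -1))
          = 2 * ((1 - y ^ 2) * (y ^ 4 + 6 * 1 * y ^ 2 + 1 ^ 2)) := by
        obtain ⟨d, rfl⟩ : ∃ d, y = 1 - d := ⟨1 - y, by ring⟩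
        rw [show -1 * (1 - d) + 1 = d by ring] at hy' ⊢
        field_simp
        ring
      rw [this, map_mul, h2, one_mul]
  simp only [Equiv.inv_apply, h, Finset.sum_add_distrib, hs]
  simp only [Finset.sum_ite_eq', Finset.mem_univ, if_true]
  ring

theorem quintic_identity (hq : Fintype.card F % 8 = 1) {n : F} (hn : quadraticChar F n = -1) :
    2 * (∑ x, quadraticChar F (x ^ 3 + 4 * x ^ 2 + 2 * x)) ^ 2
      + (∑ x, quadraticChar F (x ^ 5 + n * x)) ^ 2 = 8 * (Fintype.card F : ℤ) := by
  have hF : ringChar F ≠ 2 := fun h => by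
    have := FiniteField.even_card_of_char_two h
    omega
  have two : (2 : F) ≠ 0 := Ring.two_ne_zero hF
  have h1 : quadraticChar F (-1) = 1 :=
    (quadraticChar_one_iff_isSquare (neg_ne_zero.mpr one_ne_zero)).mpr
      (FiniteField.isSquare_neg_one_iff.mpr (by omega))
  have h2 : quadraticChar F 2 = 1 :=
    (quadraticChar_one_iff_isSquare two).mpr (FiniteField.isSquare_two_iff.mpr (by omega))
  -- The exponent 2j + 1 = q - 2 is inversion on nonzero elements.
  obtain ⟨j, hj, hqj⟩ : ∃ j, Odd j ∧ 2 * j + 1 + 1 = Fintype.card F - 1 := by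
    have := Fintype.one_lt_card (α := F)
    refine ⟨(Fintype.card F - 3) / 2, ?_, ?_⟩
    · rw [Nat.odd_iff]; omega
    · omega
  have hinv : ∀ m : F, m ≠ 0 → m * m ^ (2 * j + 1) = 1 := fun m hm => by
    rw [← pow_succ', hqj, FiniteField.pow_card_sub_one_eq_one m hm]
  have key : ∀ m : F, m ≠ 0 → ∑ x, quadraticChar F (x ^ 5 + m ^ (2 * j + 1) * x)
      = quadraticChar F m * ∑ x, quadraticChar F (x ^ 5 + m * x) := by
    intro m hm
    rw [← Equiv.sum_comp (Equiv.inv F), Finset.mul_sum]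
    refine Finset.sum_congr rfl fun x _ => ?_
    rw [← map_mul, Equiv.inv_apply]
    rcases eq_or_ne x 0 with rfl | hx
    · simp
    rw [← quadraticChar_sq_mul _ (mul_ne_zero hm (pow_ne_zero 3 hx))]
    congr 1
    have e : m ^ (2 * j + 1) = m⁻¹ := by
      rw [eq_comm, inv_eq_of_mul_eq_one_right (hinv m hm)]
    rw [e]
    field_simp
    ring
  have := four_mul_sum_sq hF (fun n : F => ∑ x, quadraticChar F (x ^ 5 + n * x)) ?_ hj ?_ ?_ ?_ hn
  · rw [sum_sq_quintic hF h1 h2, sum_quintic_one hF h1 h2] at this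
    have hq1 : ((Fintype.card F : ℤ) - 1) ≠ 0 := by
      have := Fintype.one_lt_card (α := F)
      omega
    have := mul_left_cancel₀ hq1 (this.symm.trans (by ring :
      _ = ((Fintype.card F : ℤ) - 1) * (16 * (Fintype.card F : ℤ))))
    linarith
  · rw [← quadraticChar_sum_zero hF]
    refine Finset.sum_congr rfl fun x _ => ?_
    rcases eq_or_ne x 0 with rfl | hx
    · simp
    rw [← quadraticChar_sq_mul x (pow_ne_zero 2 hx)]
    congr 1
    ring
  · intro m n hm
    rw [← sum_comp_affine _ hm 0, Finset.mul_sum]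
    refine Finset.sum_congr rfl fun x _ => ?_
    rw [← map_mul, ← quadraticChar_sq_mul (m * _) (pow_ne_zero 2 hm)]
    congr 1
    ring
  · intro m hm
    simp only [key m hm, mul_pow, quadraticChar_sq_one hm, one_mul]
  · intro m hm
    simp only [key _ (pow_ne_zero 2 hm), quadraticChar_sq_one' hm, one_mul]

end QuinticSums

/-! ### The case p ≡ 3 (mod 8): sums over 𝔽_p(√2) -/

/-- A scaling-invariant sum over the plane is p - 1 (for 𝔽_p) times a sum over the projective line;
`g 1 0` is the point at infinity, the source of the `1 +` in B. -/
theorem sum_sum_of_homogeneous {F : Type*} [Field F] [Fintype F]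
    (g : F → F → ℤ) (g0 : g 0 0 = 0) (hg : ∀ a x y, a ≠ 0 → g (a * x) (a * y) = g x y) :
    ∑ x, ∑ y, g x y = ((Fintype.card F : ℤ) - 1) * (g 1 0 + ∑ t, g t 1) := by
  classical
  have h : ∀ y, ∑ x, g x y = ∑ t, g t 1 +
      if y = 0 then ((Fintype.card F : ℤ) - 1) * g 1 0 - ∑ t, g t 1 else 0 := by
    intro y
    split_ifs with hy
    · subst hy
      have : ∀ x, g x 0 = g 1 0 - if x = 0 then g 1 0 else 0 := by
        intro x
        split_ifs with hx
        · rw [hx, g0, sub_self]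
        · have := hg x 1 0 hx
          rw [mul_one, mul_zero] at this
          rw [this, sub_zero]
      rw [Finset.sum_congr rfl fun x _ => this x, Finset.sum_sub_distrib]
      simp
      ring
    · rw [add_zero, ← sum_comp_affine _ hy 0]
      refine Finset.sum_congr rfl fun t _ => ?_
      have := hg y t 1 hy
      rwa [mul_one, ← add_zero (y * t)] at this
  rw [Finset.sum_comm, Finset.sum_congr rfl fun y _ => h y, Finset.sum_add_distrib]
  simp
  ring

namespace QuadraticAlgebra

instance {R : Type*} [Fintype R] (a b : R) : Fintype (QuadraticAlgebra R a b) :=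
  Fintype.ofEquiv _ (equivProd a b).symm

theorem card_eq_sq {R : Type*} [Fintype R] (a b : R) :
    Fintype.card (QuadraticAlgebra R a b) = Fintype.card R ^ 2 := by
  rw [Fintype.card_congr (equivProd a b), Fintype.card_prod, sq]

theorem sum_eq_sum_sum {R : Type*} [Fintype R] {a b : R} (f : QuadraticAlgebra R a b → ℤ) :
    ∑ z, f z = ∑ x, ∑ y, f ⟨x, y⟩ := by
  rw [← Fintype.sum_prod_type', ← Equiv.sum_comp (equivProd a b).symm]
  rfl

end QuadraticAlgebra

/-- The ring obtained from `ZMod p` by adjoining a square root of `2`. -/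
abbrev SqrtTwo (p : ℕ) := QuadraticAlgebra (ZMod p) 2 0

namespace SqrtTwo

open QuadraticAlgebra

variable {p : ℕ} [Fact p.Prime]

theorem re_mul_pow_four (c z : SqrtTwo p) : (c * z ^ 4).re =
    c.re * (z.re ^ 4 + 12 * z.re ^ 2 * z.im ^ 2 + 4 * z.im ^ 4)
      + c.im * (8 * z.re ^ 3 * z.im + 16 * z.re * z.im ^ 3) := by
  rw [show z ^ 4 = z * z * (z * z) by ring]
  simp only [re_mul, im_mul]
  ring

theorem im_pow_four (z : SqrtTwo p) : (z ^ 4).im = 4 * (z.re * z.im * (z.re ^ 2 + 2 * z.im ^ 2)) := by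
  rw [show z ^ 4 = z * z * (z * z) by ring]
  simp only [re_mul, im_mul]
  ring

theorem fact_of_quadraticChar_two (h2 : quadraticChar (ZMod p) 2 = -1) :
    Fact (∀ r : ZMod p, r ^ 2 ≠ 2 + 0 * r) :=
  ⟨fun r hr => quadraticChar_neg_one_iff_not_isSquare.mp h2 ⟨r, by linear_combination -hr⟩⟩

variable [Fact (∀ r : ZMod p, r ^ 2 ≠ 2 + 0 * r)]

theorem ringChar_ne_two (hp : p ≠ 2) : ringChar (SqrtTwo p) ≠ 2 := by
  have : CharP (SqrtTwo p) p := charP_of_injective_algebraMap (algebraMap (ZMod p) (SqrtTwo p)).injective p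
  rwa [ringChar.eq (SqrtTwo p) p]

theorem pow_char_eq_star (hp : p ≠ 2) (h2 : quadraticChar (ZMod p) 2 = -1) (z : SqrtTwo p) :
    z ^ p = star z := by
  have : CharP (SqrtTwo p) p := charP_of_injective_algebraMap (algebraMap (ZMod p) (SqrtTwo p)).injective p
  have hodd := (Fact.out : p.Prime).eq_two_or_odd.resolve_left hp
  have hF : ringChar (ZMod p) ≠ 2 := by rwa [ZMod.ringChar_zmod_n]
  have hz : z = algebraMap (ZMod p) (SqrtTwo p) z.re + algebraMap (ZMod p) (SqrtTwo p) z.im * ⟨0, 1⟩ := by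
    ext <;> simp
  have h2' : (2 : ZMod p) ^ (p / 2) = -1 := by
    have := quadraticChar_eq_pow_of_char_ne_two' hF 2
    rw [h2, ZMod.card] at this
    rw [← this]; simp
  have hω : (⟨0, 1⟩ : SqrtTwo p) ^ p = -⟨0, 1⟩ := by
    have e : (⟨0, 1⟩ : SqrtTwo p) ^ 2 = algebraMap (ZMod p) (SqrtTwo p) 2 := by
      rw [sq]
      ext <;> simp
    have : (⟨0, 1⟩ : SqrtTwo p) ^ p = (⟨0, 1⟩ ^ 2) ^ (p / 2) * ⟨0, 1⟩ := by
      rw [← pow_mul, ← pow_succ]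
      congr 1
      omega
    rw [this, e, ← map_pow, h2', map_neg, map_one, neg_one_mul]
  have : z ^ p = algebraMap (ZMod p) (SqrtTwo p) z.re + algebraMap (ZMod p) (SqrtTwo p) z.im * -⟨0, 1⟩ := by
    conv_lhs => rw [hz]
    rw [add_pow_char, mul_pow, hω, ← map_pow, ← map_pow, ZMod.pow_card, ZMod.pow_card]
  rw [this]
  ext <;> simp

/-- By Euler's criterion: z^((p²-1)/2) = (z·z^p)^((p-1)/2), and z·z^p is the norm. -/
theorem quadraticChar_eq_quadraticChar_norm (hp : p ≠ 2) (h2 : quadraticChar (ZMod p) 2 = -1) (z : SqrtTwo p) :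
    quadraticChar (SqrtTwo p) z = quadraticChar (ZMod p) (norm z) := by
  have hodd := (Fact.out : p.Prime).eq_two_or_odd.resolve_left hp
  have hF : ringChar (ZMod p) ≠ 2 := by rwa [ZMod.ringChar_zmod_n]
  have hK : ringChar (SqrtTwo p) ≠ 2 := ringChar_ne_two hp
  refine (quadraticChar_isQuadratic (SqrtTwo p)).eq_of_eq_coe (quadraticChar_isQuadratic (ZMod p)) hK ?_
  have e : Fintype.card (SqrtTwo p) / 2 = (p + 1) * (p / 2) := by
    rw [card_eq_sq, ZMod.card]
    obtain ⟨k, rfl⟩ : ∃ k, p = 2 * k + 1 := ⟨p / 2, by omega⟩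
    rw [show (2 * k + 1) / 2 = k by omega]
    have : (2 * k + 1) ^ 2 = 2 * ((2 * k + 1 + 1) * k) + 1 := by ring
    omega
  have h := congrArg (algebraMap (ZMod p) (SqrtTwo p)) (quadraticChar_eq_pow_of_char_ne_two' hF (norm z))
  rw [map_intCast, map_pow, ZMod.card, algebraMap_norm_eq_mul_star,
    ← pow_char_eq_star hp h2, ← pow_succ', ← pow_mul] at h
  rw [h, ← e, quadraticChar_eq_pow_of_char_ne_two' hK]

end SqrtTwo

namespace SqrtTwo

open QuadraticAlgebra

variable {p : ℕ} [Fact p.Prime]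

theorem sum_re_mul_re (hp : p ≠ 2) (c : SqrtTwo p) :
    ∑ z : SqrtTwo p, quadraticChar (ZMod p) z.re * quadraticChar (ZMod p) (c * z).re
      = (p : ℤ) * ((p : ℤ) - 1) * if c.im = 0 then quadraticChar (ZMod p) c.re else 0 := by
  have hF : ringChar (ZMod p) ≠ 2 := by rwa [ZMod.ringChar_zmod_n]
  have two : (2 : ZMod p) ≠ 0 := Ring.two_ne_zero hF
  rw [sum_eq_sum_sum]
  split_ifs with hc
  · have e : ∀ x y : ZMod p, quadraticChar (ZMod p) x *
        quadraticChar (ZMod p) (c * ⟨x, y⟩).re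
        = quadraticChar (ZMod p) x ^ 2 * quadraticChar (ZMod p) c.re := by
      intro x y
      rw [re_mul]
      simp only [hc, mul_zero, zero_mul, add_zero, map_mul]
      ring
    simp_rw [e, ← Finset.sum_mul, Finset.sum_const, ← Finset.smul_sum, sum_quadraticChar_sq,
      Finset.card_univ, ZMod.card, nsmul_eq_mul]
  · have e : ∀ x y : ZMod p, quadraticChar (ZMod p) x *
        quadraticChar (ZMod p) (c * ⟨x, y⟩).re
        = quadraticChar (ZMod p) x * quadraticChar (ZMod p) ((2 * c.im) * y + c.re * x) := by
      intro x y
      rw [re_mul]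
      congr 2
      ring
    simp_rw [e, ← Finset.mul_sum, sum_quadraticChar_affine hF (mul_ne_zero two hc), mul_zero,
      Finset.sum_const_zero]

variable [Fact (∀ r : ZMod p, r ^ 2 ≠ 2 + 0 * r)]

/-- The quartic character sum `∑ η(w) χ(Re (c w⁴))` over `𝔽_p(√2)`, where `χ` and `η` are the
quadratic characters of `𝔽_p` and `𝔽_p(√2)`. -/
noncomputable def quarticSum (c : SqrtTwo p) : ℤ :=
  ∑ w : SqrtTwo p, quadraticChar (SqrtTwo p) w * quadraticChar (ZMod p) (c * w ^ 4).re

theorem quarticSum_zero : quarticSum (0 : SqrtTwo p) = 0 := by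
  simp [quarticSum, quadraticChar_zero, -quadraticChar_apply]

theorem quarticSum_pow_four_mul (m n : SqrtTwo p) (hm : m ≠ 0) :
    quarticSum (m ^ 4 * n) = quadraticChar (SqrtTwo p) m * quarticSum n := by
  rw [quarticSum, quarticSum, ← sum_comp_affine (fun w => quadraticChar (SqrtTwo p) w *
    quadraticChar (ZMod p) (n * w ^ 4).re) hm 0, Finset.mul_sum]
  refine Finset.sum_congr rfl fun w _ => ?_
  rw [add_zero, ← mul_assoc, ← map_mul, ← mul_assoc m, ← sq, quadraticChar_sq_mul _ hm]
  congr 3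
  ring

theorem quarticSum_star (hp : p ≠ 2) (h2 : quadraticChar (ZMod p) 2 = -1) (c : SqrtTwo p) :
    quarticSum (star c) = quarticSum c := by
  rw [quarticSum, ← Equiv.sum_comp (starMulAut (R := SqrtTwo p)).toEquiv]
  refine Finset.sum_congr rfl fun w _ => ?_
  simp only [MulEquiv.toEquiv_eq_coe, EquivLike.coe_coe, starMulAut_apply]
  rw [quadraticChar_eq_quadraticChar_norm hp h2, quadraticChar_eq_quadraticChar_norm hp h2,
    QuadraticAlgebra.norm_star, ← star_pow, ← star_mul', re_star, zero_mul, add_zero]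

theorem quarticSum_eq (hp : p ≠ 2) (h2 : quadraticChar (ZMod p) 2 = -1) (c : SqrtTwo p) :
    quarticSum c = ((p : ℤ) - 1) * (quadraticChar (ZMod p) c.re +
      ∑ t, quadraticChar (ZMod p) ((t ^ 2 - 2) *
        (c.re * (t ^ 4 + 12 * t ^ 2 + 4) + c.im * (8 * t ^ 3 + 16 * t)))) := by
  have := sum_sum_of_homogeneous (fun x y : ZMod p => quadraticChar (ZMod p)
    ((x ^ 2 - 2 * y ^ 2) * (c.re * (x ^ 4 + 12 * x ^ 2 * y ^ 2 + 4 * y ^ 4)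
      + c.im * (8 * x ^ 3 * y + 16 * x * y ^ 3)))) (by simp) ?_
  · rw [quarticSum, sum_eq_sum_sum]
    rw [ZMod.card] at this
    have e : ∀ x y : ZMod p, quadraticChar (SqrtTwo p) ⟨x, y⟩ *
        quadraticChar (ZMod p) (c * (⟨x, y⟩ : SqrtTwo p) ^ 4).re = quadraticChar (ZMod p)
        ((x ^ 2 - 2 * y ^ 2) * (c.re * (x ^ 4 + 12 * x ^ 2 * y ^ 2 + 4 * y ^ 4)
          + c.im * (8 * x ^ 3 * y + 16 * x * y ^ 3))) := by
      intro x y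
      rw [quadraticChar_eq_quadraticChar_norm hp h2, ← map_mul, re_mul_pow_four, norm_def]
      congr 1
      ring
    simp_rw [e]
    rw [this]
    congr 2
    · congr 1; ring
    · refine Finset.sum_congr rfl fun t _ => ?_
      congr 1; ring
  · intro a x y ha
    rw [← quadraticChar_sq_mul ((x ^ 2 - 2 * y ^ 2) * _) (pow_ne_zero 3 ha)]
    congr 1
    ring

theorem sum_pow_four_real (hp : p ≠ 2) (h2 : quadraticChar (ZMod p) 2 = -1)
    (hn2 : quadraticChar (ZMod p) (-2) = 1) :
    ∑ u : SqrtTwo p, quadraticChar (SqrtTwo p) u *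
      (if (u ^ 4).im = 0 then quadraticChar (ZMod p) (u ^ 4).re else 0) = 4 * ((p : ℤ) - 1) := by
  have hF : ringChar (ZMod p) ≠ 2 := by rwa [ZMod.ringChar_zmod_n]
  have two : (2 : ZMod p) ≠ 0 := Ring.two_ne_zero hF
  have four : (4 : ZMod p) ≠ 0 := by
    rw [show (4 : ZMod p) = 2 * 2 by norm_num]; exact mul_ne_zero two two
  obtain ⟨r, hr, hr2⟩ := exists_sq_of_quadraticChar_eq_one hn2
  have e : ∀ x y : ZMod p, quadraticChar (SqrtTwo p) ⟨x, y⟩ *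
      (if ((⟨x, y⟩ : SqrtTwo p) ^ 4).im = 0 then
        quadraticChar (ZMod p) ((⟨x, y⟩ : SqrtTwo p) ^ 4).re else 0)
      = if x * y * (x ^ 2 + 2 * y ^ 2) = 0 then quadraticChar (ZMod p)
        ((x ^ 2 - 2 * y ^ 2) * (x ^ 4 + 12 * x ^ 2 * y ^ 2 + 4 * y ^ 4)) else 0 := by
    intro x y
    have hre := re_mul_pow_four (1 : SqrtTwo p) ⟨x, y⟩
    have hz : ((⟨x, y⟩ : SqrtTwo p) ^ 4).im = 0 ↔ x * y * (x ^ 2 + 2 * y ^ 2) = 0 := by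
      rw [im_pow_four, mul_eq_zero_iff_left four]
    rw [one_mul, re_one, im_one, one_mul, zero_mul, add_zero] at hre
    rw [if_congr hz rfl rfl, quadraticChar_eq_quadraticChar_norm hp h2, mul_ite, mul_zero,
      ← map_mul, hre, norm_def]
    congr 3
    ring
  rw [sum_eq_sum_sum]
  simp_rw [e]
  rw [sum_sum_of_homogeneous (fun x y : ZMod p => if x * y * (x ^ 2 + 2 * y ^ 2) = 0 then
    quadraticChar (ZMod p) ((x ^ 2 - 2 * y ^ 2) * (x ^ 4 + 12 * x ^ 2 * y ^ 2 + 4 * y ^ 4))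
    else 0) (by simp) ?_, ZMod.card]
  -- Four projective points have u⁴ in 𝔽_p: infinity, 0 and ±√-2. The summand is 1 at each, the
  -- sextic being 1, -8 and 64 (twice).
  · have hset : (Finset.univ.filter fun t : ZMod p => t * 1 * (t ^ 2 + 2 * 1 ^ 2) = 0)
        = {0, r, -r} := by
      ext t
      simp only [Finset.mem_filter, Finset.mem_univ, true_and, Finset.mem_insert,
        Finset.mem_singleton]
      have : t * 1 * (t ^ 2 + 2 * 1 ^ 2) = t * ((t - r) * (t + r)) := by
        linear_combination -t * hr2
      rw [this]
      simp [sub_eq_zero, add_eq_zero_iff_eq_neg]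
    have e6 : r ≠ -r := fun h => mul_ne_zero two hr (by linear_combination h)
    have v : ∀ t : ZMod p, t ^ 2 = -2 → quadraticChar (ZMod p)
        ((t ^ 2 - 2 * 1 ^ 2) * (t ^ 4 + 12 * t ^ 2 * 1 ^ 2 + 4 * 1 ^ 4)) = 1 := by
      intro t ht
      rw [show t ^ 4 = (t ^ 2) ^ 2 by ring, ht, ← quadraticChar_sq_one' (pow_ne_zero 3 two)]
      congr 1
      ring
    rw [← Finset.sum_filter, hset, Finset.sum_insert (by simp [hr, eq_comm]),
      Finset.sum_pair e6, v r hr2.symm, v (-r) (by rw [neg_sq, hr2])]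
    have v0 : quadraticChar (ZMod p)
        ((0 ^ 2 - 2 * 1 ^ 2) * (0 ^ 4 + 12 * 0 ^ 2 * 1 ^ 2 + 4 * 1 ^ 4)) = 1 := by
      rw [← hn2, ← quadraticChar_sq_mul (-2) two]
      congr 1
      ring
    rw [v0]
    simp [-quadraticChar_apply]
    ring
  · intro a x y ha
    refine if_congr ?_ ?_ rfl
    · rw [← mul_eq_zero_iff_left (pow_ne_zero 4 ha) (b := x * y * (x ^ 2 + 2 * y ^ 2))]
      ring_nf
    · rw [← quadraticChar_sq_mul ((x ^ 2 - 2 * y ^ 2) * _) (pow_ne_zero 3 ha)]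
      congr 1
      ring

/-- Orthogonality as in the quintic case: with v = wu, the sum over c keeps only those u with u⁴ in
𝔽_p. -/
theorem sum_sq_quarticSum (hp : p ≠ 2) (h2 : quadraticChar (ZMod p) 2 = -1)
    (hn2 : quadraticChar (ZMod p) (-2) = 1) :
    ∑ c : SqrtTwo p, quarticSum c ^ 2
      = 4 * (p : ℤ) * ((p : ℤ) - 1) ^ 2 * ((p : ℤ) ^ 2 - 1) := by
  have expand : ∀ c : SqrtTwo p, quarticSum c ^ 2
      = ∑ w, ∑ v, quadraticChar (SqrtTwo p) w * quadraticChar (SqrtTwo p) v *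
        (quadraticChar (ZMod p) (c * w ^ 4).re * quadraticChar (ZMod p) (c * v ^ 4).re) := by
    intro c
    rw [sq, quarticSum, Finset.sum_mul_sum]
    exact Finset.sum_congr rfl fun x _ => Finset.sum_congr rfl fun y _ => by ring
  have inner : ∀ w : SqrtTwo p, ∑ v, quadraticChar (SqrtTwo p) w * quadraticChar (SqrtTwo p) v *
      ∑ c : SqrtTwo p, quadraticChar (ZMod p) (c * w ^ 4).re *
        quadraticChar (ZMod p) (c * v ^ 4).re
      = 4 * (p : ℤ) * ((p : ℤ) - 1) ^ 2 * quadraticChar (SqrtTwo p) w ^ 2 := by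
    intro w
    rcases eq_or_ne w 0 with rfl | hw
    · simp [quadraticChar_zero, -quadraticChar_apply]
    have h : ∀ u : SqrtTwo p, ∑ c : SqrtTwo p, quadraticChar (ZMod p) (c * w ^ 4).re *
        quadraticChar (ZMod p) (c * (w * u + 0) ^ 4).re
        = (p : ℤ) * ((p : ℤ) - 1) *
          if (u ^ 4).im = 0 then quadraticChar (ZMod p) (u ^ 4).re else 0 := by
      intro u
      rw [← sum_re_mul_re hp, ← sum_comp_affine (fun z : SqrtTwo p =>
        quadraticChar (ZMod p) z.re * quadraticChar (ZMod p) (u ^ 4 * z).re)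
        (pow_ne_zero 4 hw) 0]
      refine Finset.sum_congr rfl fun c _ => ?_
      rw [add_zero, add_zero, mul_comm c, mul_pow]
      congr 3
      ring
    rw [← sum_comp_affine _ hw 0]
    simp_rw [h, add_zero, map_mul]
    rw [show 4 * (p : ℤ) * ((p : ℤ) - 1) ^ 2 * quadraticChar (SqrtTwo p) w ^ 2
      = (p : ℤ) * ((p : ℤ) - 1) * quadraticChar (SqrtTwo p) w ^ 2 * (4 * ((p : ℤ) - 1)) by ring,
      ← sum_pow_four_real hp h2 hn2, Finset.mul_sum]
    exact Finset.sum_congr rfl fun u _ => by ring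
  rw [Finset.sum_congr rfl fun c _ => expand c, Finset.sum_comm]
  simp_rw [fun w : SqrtTwo p => Finset.sum_comm (s := (Finset.univ : Finset (SqrtTwo p)))
    (t := Finset.univ) (f := fun c v => quadraticChar (SqrtTwo p) w * quadraticChar (SqrtTwo p) v *
      (quadraticChar (ZMod p) (c * w ^ 4).re * quadraticChar (ZMod p) (c * v ^ 4).re)),
    ← Finset.mul_sum, inner]
  rw [← Finset.mul_sum, sum_quadraticChar_sq, card_eq_sq, ZMod.card]
  push_cast
  ring

end SqrtTwo

/-! ### The identity for p ≡ 3 (mod 8) and the conclusion -/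

open QuadraticAlgebra in
theorem sextic_identity {p : ℕ} [Fact p.Prime] (hp8 : p % 8 = 3) :
    2 * (∑ x, quadraticChar (ZMod p) (x ^ 3 + 4 * x ^ 2 + 2 * x)) ^ 2
      + (1 + ∑ x, quadraticChar (ZMod p)
        (x ^ 6 + 4 * x ^ 5 + 10 * x ^ 4 - 20 * x ^ 2 - 16 * x - 8)) ^ 2 = 8 * (p : ℤ) := by
  have hp : p ≠ 2 := by omega
  have hF : ringChar (ZMod p) ≠ 2 := by rwa [ZMod.ringChar_zmod_n]
  have two : (2 : ZMod p) ≠ 0 := Ring.two_ne_zero hF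
  have h2 : quadraticChar (ZMod p) 2 = -1 :=
    quadraticChar_neg_one_iff_not_isSquare.mpr fun h => by
      rw [ZMod.exists_sq_eq_two_iff hp] at h
      omega
  have hn2 : quadraticChar (ZMod p) (-2) = 1 :=
    (quadraticChar_one_iff_isSquare (neg_ne_zero.mpr two)).mpr
      ((ZMod.exists_sq_eq_neg_two_iff hp).mpr (Or.inr hp8))
  have h1 : quadraticChar (ZMod p) (-1) = -1 := by
    rw [show (-2 : ZMod p) = -1 * 2 by ring, map_mul, h2] at hn2
    linarith
  have := SqrtTwo.fact_of_quadraticChar_two h2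
  obtain ⟨j, hj, hpj⟩ : ∃ j, Odd j ∧ 2 * j + 1 = p :=
    ⟨p / 2, by rw [Nat.odd_iff]; omega, by omega⟩
  have half : (2 : ZMod p) * 2⁻¹ = 1 := mul_inv_cancel₀ two
  -- c = 1 + √2/2 has norm 1/2, a nonsquare, so c is a nonsquare; it turns the sextic of
  -- `quarticSum_eq` into the one defining B.
  let c : SqrtTwo p := ⟨1, 2⁻¹⟩
  have hc : quadraticChar (SqrtTwo p) c = -1 := by
    rw [SqrtTwo.quadraticChar_eq_quadraticChar_norm hp h2, norm_def, ← h2,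
      ← quadraticChar_sq_mul _ two]
    congr 1
    simp only [c]
    linear_combination (-4 * 2⁻¹ - 2 : ZMod p) * half
  have hstar : ∀ z : SqrtTwo p, SqrtTwo.quarticSum (z ^ (2 * j + 1)) = SqrtTwo.quarticSum z :=
    fun z => by rw [hpj, SqrtTwo.pow_char_eq_star hp h2, SqrtTwo.quarticSum_star hp h2]
  have key := four_mul_sum_sq (SqrtTwo.ringChar_ne_two hp) SqrtTwo.quarticSum
    SqrtTwo.quarticSum_zero hj SqrtTwo.quarticSum_pow_four_mul
    (fun n _ => by rw [hstar]) (fun m _ => hstar _) hc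
  have e1 : SqrtTwo.quarticSum (1 : SqrtTwo p) = ((p : ℤ) - 1) *
      (2 * ∑ x, quadraticChar (ZMod p) (x ^ 3 + 4 * x ^ 2 + 2 * x)) := by
    have hs := sum_quadraticChar_sextic hF 2 two
    have e : ∀ x : ZMod p, quadraticChar (ZMod p) ((x ^ 2 - 2) *
        (1 * (x ^ 4 + 12 * x ^ 2 + 4) + 0 * (8 * x ^ 3 + 16 * x)))
        = -quadraticChar (ZMod p) ((2 - x ^ 2) * (x ^ 4 + 6 * 2 * x ^ 2 + 2 ^ 2)) := by
      intro x
      rw [← neg_one_mul (quadraticChar (ZMod p) _), ← h1, ← map_mul]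
      congr 1
      ring
    rw [SqrtTwo.quarticSum_eq hp h2, re_one, im_one, map_one]
    simp_rw [e]
    rw [Finset.sum_neg_distrib, hs, h1, h2, sum_quadraticChar_cubic hF, hn2]
    ring
  have e2 : SqrtTwo.quarticSum c = ((p : ℤ) - 1) * (1 + ∑ x, quadraticChar (ZMod p)
      (x ^ 6 + 4 * x ^ 5 + 10 * x ^ 4 - 20 * x ^ 2 - 16 * x - 8)) := by
    rw [SqrtTwo.quarticSum_eq hp h2]
    congr 2
    · exact map_one _
    · refine Finset.sum_congr rfl fun x _ => ?_
      congr 1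
      simp only [c]
      linear_combination (x ^ 2 - 2) * (4 * x ^ 3 + 8 * x) * half
  rw [SqrtTwo.sum_sq_quarticSum hp h2 hn2, e1, e2, card_eq_sq, ZMod.card] at key
  push_cast at key
  have hp1 : (p : ℤ) - 1 ≠ 0 := by omega
  have hp2 : (p : ℤ) ^ 2 - 1 ≠ 0 := by
    have : (p : ℤ) + 1 ≠ 0 := by omega
    rw [show (p : ℤ) ^ 2 - 1 = (p - 1) * (p + 1) by ring]
    exact mul_ne_zero hp1 this
  refine mul_left_cancel₀ (mul_ne_zero (mul_ne_zero two_ne_zero (pow_ne_zero 2 hp1)) hp2) ?_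
  linear_combination -key

theorem jacobsthalSum_eq (p : ℕ) [Fact p.Prime] (f : ℤ[X]) :
    jacobsthalSum p f = ∑ x : ZMod p, quadraticChar (ZMod p) (f.eval₂ (Int.castRingHom _) x) := by
  rw [jacobsthalSum]
  refine Finset.sum_bij' (fun x _ => (x : ZMod p)) (fun x _ => x.val) (by simp)
    (fun x _ => Finset.mem_range.mpr x.val_lt)
    (fun x hx => ZMod.val_cast_of_lt (Finset.mem_range.mp hx)) (by simp) fun x _ => ?_
  rw [legendreSym, ← eq_intCast (Int.castRingHom (ZMod p)), Polynomial.eval, Polynomial.hom_eval₂]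
  simp

theorem exists_int_sq_add_two_mul_sq (p : ℕ) (J S : ℤ) (h : 2 * J ^ 2 + S ^ 2 = 8 * (p : ℤ)) :
    (∃ a : ℤ, (1 / 2 : ℚ) * J = a) ∧ (∃ b : ℤ, (1 / 4 : ℚ) * S = b) ∧
      ((1 / 2 : ℚ) * J) ^ 2 + 2 * ((1 / 4 : ℚ) * S) ^ 2 = p := by
  have even_of_sq : ∀ a b : ℤ, a ^ 2 = 2 * b → ∃ c, a = 2 * c := fun a b hab =>
    Int.prime_two.dvd_of_dvd_pow ⟨b, hab⟩
  -- Descent by parity: J² + 2s² = 4p, then 2j² + s² = 2p, then j² + 2t² = p.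
  obtain ⟨s, rfl⟩ := even_of_sq S (4 * p - J ^ 2) (by linarith)
  obtain ⟨j, rfl⟩ := even_of_sq J (2 * p - s ^ 2) (by linarith)
  obtain ⟨t, rfl⟩ := even_of_sq s (p - j ^ 2) (by linarith)
  refine ⟨⟨j, by push_cast; ring⟩, ⟨t, by push_cast; ring⟩, ?_⟩
  have h' : j ^ 2 + 2 * t ^ 2 = (p : ℤ) := by linarith
  have := congrArg (Int.cast : ℤ → ℚ) h'
  push_cast at this ⊢
  linarith

theorem mainTheorem1 (p : ℕ) [Fact p.Prime] :
    (p ≡ 1 [MOD 8] → ∀ n : ℤ, ¬ IsSquare (n : ZMod p) →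
      (∃ a : ℤ, sumA p = (a : ℚ)) ∧ (∃ b : ℤ, sumB₁ p n = (b : ℚ)) ∧
        sumA p ^ 2 + 2 * sumB₁ p n ^ 2 = (p : ℚ)) ∧
    (p ≡ 3 [MOD 8] →
      (∃ a : ℤ, sumA p = (a : ℚ)) ∧ (∃ b : ℤ, sumB₃ p = (b : ℚ)) ∧
        sumA p ^ 2 + 2 * sumB₃ p ^ 2 = (p : ℚ)) := by
  constructor
  · intro hp n hn
    apply exists_int_sq_add_two_mul_sq
    have := quintic_identity (F := ZMod p) (by rwa [ZMod.card])
      (quadraticChar_neg_one_iff_not_isSquare.mpr hn)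
    rw [ZMod.card] at this
    have h : ∀ x : ZMod p, (X ^ 5 + C n * X).eval₂ (Int.castRingHom _) x = x ^ 5 + n * x :=
      fun x => by rw [eval₂_add, eval₂_mul, eval₂_C]; simp
    rw [jacobsthalSum_eq, jacobsthalSum_eq]
    simp_rw [h]
    simpa [eval₂_ofNat, -quadraticChar_apply] using this
  · intro hp
    have := sextic_identity hp
    rw [sumA, sumB₃, ← Int.cast_one, ← Int.cast_add]
    apply exists_int_sq_add_two_mul_sq
    rw [jacobsthalSum_eq, jacobsthalSum_eq]
    simpa [eval₂_ofNat, -quadraticChar_apply] using this
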